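/- All rings are associative with identity. Let $R$ be a right hereditary ring, i.e. every right ideal of $R$ is a projective right $R$-module, and let $E$ be a finitely presented injective right $R$-module. Then for every submodule $L$ of $E$ the quotient $E/L$ has finite Goldie (uniform) dimension: the supremum of all cardinals $c$ such that $E/L$ contains a direct sum of $c$ nonzero submodules is finite. -/

import Mathlib

/-- A module is hereditary when each of its submodules is projective. -/
def IsHereditaryModule (R : Type*) [Ring R] (M : Type*) [AddCommGroup M] [Module R M] : Prop :=
  ∀ N : Submodule R M, Module.Projective R N

/-- A ring `R` is right hereditary when every right ideal is projective as a right `R`-module.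
Right `R`-modules are modules over `Rᵐᵒᵖ`; the submodules of `R` over `Rᵐᵒᵖ` are the right
ideals. -/
def IsRightHereditary (R : Type*) [Ring R] : Prop :=
  IsHereditaryModule Rᵐᵒᵖ R

universe u v w

/-- The cardinals `c` such that `M` contains a direct sum of `c` nonzero submodules. -/
def goldieCardinals (R : Type*) [Ring R] (M : Type w) [AddCommGroup M] [Module R M] :
    Set Cardinal.{w} :=
  {c | ∃ (ι : Type w) (N : ι → Submodule R M),
    (∀ i, N i ≠ ⊥) ∧ iSupIndep N ∧ Cardinal.mk ι = c}

/-- The supremum below is a genuine one: a family of nonzero independent submodules of `M` has at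
most as many members as `M` has submodules. -/
theorem bddAbove_goldieCardinals (R : Type*) [Ring R] (M : Type w) [AddCommGroup M]
    [Module R M] : BddAbove (goldieCardinals R M) := by
  refine ⟨Cardinal.mk (Submodule R M), ?_⟩
  rintro c ⟨ι, N, hN, hind, rfl⟩
  exact Cardinal.mk_le_of_injective (hind.injective hN)

/-- The Goldie (uniform) dimension of `M`: the supremum of all cardinals `c` such that `M` contains
a direct sum of `c` nonzero submodules. -/
noncomputable def goldieDim (R : Type*) [Ring R] (M : Type w) [AddCommGroup M] [Module R M] :
    Cardinal.{w} :=
  sSup (goldieCardinals R M)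

/-!
Let `A = Rᵐᵒᵖ`, so that `E` is a finitely presented injective module over a hereditary ring. Since
ideals are projective, Baer's criterion shows that all quotients of `E` are injective
(`Module.Baer.quotient`). The proof shows that `E` is noetherian; its quotients are then noetherian
as well, and noetherian modules have finite Goldie dimension.

*No infinite direct sums in `E`* (`exists_eq_bot_of_iSupIndep`). Suppose `E` contains a direct sum
`C` of nonzero submodules `E n`, `n : ℕ`, which may be taken to be direct summands of `E`. Choose a
family of almost disjoint infinite sets `B t ⊆ ℕ`, one for each set `t` of natural numbers, and
let `H t` be an injective hull in `E` of the partial sum over `B t`. The images of the `H t` in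
`E ⧸ C` are independent (`iSupIndep_map_mkQ_of_almostDisjoint`). So, for each set `S` of indices,
injectivity of `E ⧸ C` gives a map `E → E ⧸ C` that is the canonical one on `H t` for `t ∈ S` and
zero on the other `H t`, and finite presentation lifts it to an endomorphism of `E`
(`exists_lift_mkQ_iSup`). Each `H t` is finitely generated, being a direct summand of `E`, so the
lift has the prescribed behaviour on `E n` for almost all `n ∈ B t`. Thus `S` can be read off from
the subset of `ℕ` on which the lift acts as the identity, which makes the power set of the power
set of `ℕ` inject into the power set of `ℕ`.

*From there to noetherian* (`isNoetherian_of_forall_iSupIndep`). If a submodule `L` of `E` is not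
finitely generated, neither is its preimage `P` in a finite free module, and `P` is projective.
A projective module that is not finitely generated contains, independently of any given finitely
generated submodule, an infinite direct sum of nonzero submodules
(`exists_iSupIndep_of_projective_of_not_fg`). Taking the module of relations of `E` for that
submodule yields an infinite direct sum inside `E`.

The Goldie dimension is a supremum over all families, so its finiteness needs a uniform bound on
the sizes of finite independent families; `exists_card_le_of_supIndep` provides it in any modular
lattice with ascending chain condition.
-/

/-! ### Essential extensions in modular lattices -/

/-- `a` is essential in `b`: it lies below `b` and meets every nonzero element below `b`. -/
def EssentialIn {α : Type*} [Lattice α] [OrderBot α] (a b : α) : Prop :=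
  a ≤ b ∧ ∀ z ≤ b, Disjoint z a → z = ⊥

namespace EssentialIn

variable {α : Type*} [Lattice α] [OrderBot α] {a b c a' b' : α}

theorem trans (h : EssentialIn a b) (h' : EssentialIn b c) : EssentialIn a c :=
  ⟨h.1.trans h'.1, fun z hz hza => h'.2 z hz <| disjoint_iff.2 <|
    h.2 _ inf_le_right (hza.mono_left inf_le_left)⟩

theorem disjoint (h : EssentialIn a b) (hac : Disjoint a c) : Disjoint b c :=
  disjoint_iff.2 <| h.2 _ inf_le_left (hac.symm.mono_left inf_le_right)

theorem sup_right [IsModularLattice α] (h : EssentialIn a b) (hbc : Disjoint b c) :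
    EssentialIn (a ⊔ c) (b ⊔ c) := by
  refine ⟨sup_le_sup_right h.1 c, fun z hz hza => ?_⟩
  have hzc : Disjoint (z ⊔ c) a := by
    refine Disjoint.disjoint_sup_left_of_disjoint_sup_right (hbc.mono_left h.1).symm ?_
    rwa [sup_comm c a]
  have h0 : (z ⊔ c) ⊓ b = ⊥ := h.2 _ inf_le_right (hzc.mono_left inf_le_left)
  have h1 : z ⊔ c ≤ c := by
    calc z ⊔ c ≤ (c ⊔ b) ⊓ (z ⊔ c) := le_inf (sup_le (by rwa [sup_comm]) le_sup_left) le_rfl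
      _ = c ⊔ b ⊓ (z ⊔ c) := sup_inf_assoc_of_le b le_sup_right
      _ = c := by rw [inf_comm, h0, sup_bot_eq]
  exact disjoint_self.1 (hza.mono_right ((le_sup_left.trans h1).trans le_sup_right))

theorem sup [IsModularLattice α] (h : EssentialIn a b) (h' : EssentialIn a' b')
    (haa : Disjoint a a') : EssentialIn (a ⊔ a') (b ⊔ b') := by
  have h1 : Disjoint b a' := h.disjoint haa
  have h2 := h'.sup_right (h'.disjoint h1.symm)
  rw [sup_comm a' b, sup_comm b' b] at h2
  exact (h.sup_right h1).trans h2

/-- Independence passes to essential extensions, and finite independent suprema of essential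
extensions are essential. -/
theorem finsetSup [IsModularLattice α] {ι : Type*} {s : Finset ι} {f g : ι → α}
    (hs : s.SupIndep f) (h : ∀ i ∈ s, EssentialIn (f i) (g i)) :
    s.SupIndep g ∧ EssentialIn (s.sup f) (s.sup g) := by
  classical
  induction s using Finset.induction with
  | empty => exact ⟨Finset.supIndep_empty _, by simp [EssentialIn]⟩
  | insert i s hi ih =>
    obtain ⟨h1, h2⟩ := ih (hs.subset (Finset.subset_insert i s))
      fun j hj => h j (Finset.mem_insert_of_mem hj)
    have hd : Disjoint (f i) (s.sup f) :=
      hs (Finset.subset_insert i s) (Finset.mem_insert_self i s) hi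
    have hi' := h i (Finset.mem_insert_self i s)
    refine ⟨h1.insert (h2.disjoint (hi'.disjoint hd).symm).symm, ?_⟩
    rw [Finset.sup_insert, Finset.sup_insert]
    exact hi'.sup h2 hd

end EssentialIn

/-! ### Injective modules all of whose quotients are injective -/

section Baer

variable {A : Type*} [Ring A] {M Q : Type*} [AddCommGroup M] [Module A M]
  [AddCommGroup Q] [Module A Q]

/-- Over a hereditary ring, quotients of injective modules are injective. -/
theorem Module.Baer.quotient (hA : IsHereditaryModule A A) (hM : Module.Baer A M)
    (L : Submodule A M) : Module.Baer A (M ⧸ L) := by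
  intro I g
  have := hA I
  obtain ⟨f, hf⟩ := Module.projective_lifting_property L.mkQ g L.mkQ_surjective
  obtain ⟨f', hf'⟩ := hM I f
  refine ⟨L.mkQ ∘ₗ f', fun x hx => ?_⟩
  rw [LinearMap.comp_apply, hf' x hx, ← hf, LinearMap.comp_apply]

theorem Module.Baer.exists_extend_of_disjoint (hQ : Module.Baer A Q) {U V : Submodule A M}
    (h : Disjoint U V) (g : U →ₗ[A] Q) :
    ∃ q : M →ₗ[A] Q, (∀ x : U, q x = g x) ∧ ∀ x ∈ V, q x = 0 := by
  have hi : Function.Injective (V.mkQ ∘ₗ U.subtype) := by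
    rw [← LinearMap.ker_eq_bot, LinearMap.ker_eq_bot']
    rintro ⟨x, hx⟩ hx0
    have : x ∈ V := by simpa using hx0
    simpa using Submodule.disjoint_def.1 h x hx this
  obtain ⟨k, hk⟩ := hQ.extension_property _ hi g
  refine ⟨k ∘ₗ V.mkQ, fun x => ?_, fun x hx => ?_⟩
  · rw [← hk]; rfl
  · have : V.mkQ x = 0 := by simpa using hx
    rw [LinearMap.comp_apply, this, map_zero]

/-- In an injective module with injective quotients every submodule `N` has an essential extension
`H` that is a direct summand. If `Z` is a maximal submodule disjoint from `N`, then `N` is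
essential in `M ⧸ Z`, and `H` is a copy of `M ⧸ Z` inside `M`. -/
theorem exists_essentialIn_retraction (hM : Module.Baer A M)
    (hq : ∀ L : Submodule A M, Module.Baer A (M ⧸ L)) (N : Submodule A M) :
    ∃ (H : Submodule A M) (r : M →ₗ[A] M), EssentialIn N H ∧ (∀ x, r x ∈ H) ∧ ∀ x ∈ H, r x = x := by
  obtain ⟨Z, -, hZ⟩ := zorn_le_nonempty₀ {Z : Submodule A M | Disjoint Z N} (by
    intro c hc hchain y hy
    refine ⟨sSup c, ?_, fun z hz => le_sSup hz⟩
    rw [Set.mem_ofPred_eq, Submodule.disjoint_def]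
    intro x hx hxN
    obtain ⟨z, hz, hxz⟩ := (Submodule.mem_sSup_of_directed ⟨y, hy⟩ hchain.directedOn).1 hx
    exact Submodule.disjoint_def.1 (hc hz) x hxz hxN) ⊥ disjoint_bot_left
  have hZN : Disjoint Z N := hZ.prop
  have hmax : ∀ W, Z ≤ W → Disjoint W N → W ≤ Z := fun W hW hWN => hZ.le_of_ge hWN hW
  -- `h` embeds `M ⧸ Z` into `M` over `N`
  have hi : Function.Injective (Z.mkQ ∘ₗ N.subtype) := by
    rw [← LinearMap.ker_eq_bot, LinearMap.ker_eq_bot']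
    rintro ⟨x, hx⟩ hx0
    have : x ∈ Z := by simpa using hx0
    simpa using Submodule.disjoint_def.1 hZN x this hx
  obtain ⟨h, hh⟩ := hM.extension_property _ hi N.subtype
  have hN : ∀ x ∈ N, h (Z.mkQ x) = x := fun x hx => DFunLike.congr_fun hh ⟨x, hx⟩
  have key : ∀ U : Submodule A M, Disjoint U N → U ≤ LinearMap.range h → U = ⊥ := by
    intro U hU hUh
    have h1 : U.comap (h ∘ₗ Z.mkQ) ≤ Z := by
      refine hmax _ (fun x hx => ?_) ?_
      · have : Z.mkQ x = 0 := by simpa using hx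
        rw [Submodule.mem_comap, LinearMap.comp_apply, this, map_zero]
        exact U.zero_mem
      · rw [Submodule.disjoint_def]
        intro x hx hxN
        rw [Submodule.mem_comap, LinearMap.comp_apply, hN x hxN] at hx
        exact Submodule.disjoint_def.1 hU x hx hxN
    rw [eq_bot_iff]
    intro u hu
    obtain ⟨y, rfl⟩ := hUh hu
    obtain ⟨x, rfl⟩ := Z.mkQ_surjective y
    have hx : x ∈ Z := h1 hu
    have : Z.mkQ x = 0 := by simpa using hx
    rw [this, map_zero]
    exact Submodule.zero_mem _
  have hinj : Function.Injective h := by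
    rw [← LinearMap.ker_eq_bot, LinearMap.ker_eq_bot']
    intro y hy
    obtain ⟨x, rfl⟩ := Z.mkQ_surjective y
    have hW : LinearMap.ker (h ∘ₗ Z.mkQ) ≤ Z := by
      refine hmax _ (fun x hx => ?_) ?_
      · have : Z.mkQ x = 0 := by simpa using hx
        rw [LinearMap.mem_ker, LinearMap.comp_apply, this, map_zero]
      · rw [Submodule.disjoint_def]
        intro x hx hxN
        rwa [LinearMap.mem_ker, LinearMap.comp_apply, hN x hxN] at hx
    have : x ∈ Z := hW hy
    simpa using this
  obtain ⟨g, hg⟩ := (hq Z).extension_property h hinj LinearMap.id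
  refine ⟨LinearMap.range h, h ∘ₗ g, ⟨fun x hx => ⟨_, hN x hx⟩, fun z hz hzN => key z hzN hz⟩,
    fun x => ⟨_, rfl⟩, ?_⟩
  rintro _ ⟨y, rfl⟩
  have : g (h y) = y := DFunLike.congr_fun hg y
  rw [LinearMap.comp_apply, this]

end Baer

/-! ### Almost disjoint families of partial sums -/

section AlmostDisjoint

variable {A : Type*} [Ring A] {M : Type*} [AddCommGroup M] [Module A M]
  {E : ℕ → Submodule A M} {p : ℕ → M →ₗ[A] M}

theorem iSupIndep.disjoint_finsetSup_biSup {T : Type*} (hE : iSupIndep E) {s : Finset T}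
    {B : T → Set ℕ} {F : Set ℕ} (h : ∀ t ∈ s, Disjoint F (B t)) :
    Disjoint (⨆ n ∈ F, E n) (s.sup fun t => ⨆ n ∈ B t, E n) := by
  refine (hE.disjoint_biSup_biSup (t := ⋃ t ∈ s, B t) ?_).mono_right ?_
  · simpa using h
  · refine Finset.sup_le fun t ht => iSup₂_le fun n hn => ?_
    exact le_biSup E (Set.mem_biUnion ht hn)

theorem sum_projection_apply_of_mem (hid : ∀ n, ∀ x ∈ E n, p n x = x)
    (hz : ∀ m n, m ≠ n → ∀ x ∈ E n, p m x = 0) (G : Finset ℕ) {x : M}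
    (hx : x ∈ ⨆ n ∈ (G : Set ℕ), E n) : (∑ n ∈ G, p n) x = x := by
  suffices h : (⨆ n ∈ (G : Set ℕ), E n) ≤ LinearMap.eqLocus (∑ n ∈ G, p n) LinearMap.id from h hx
  refine iSup₂_le fun n hn x hx => ?_
  rw [LinearMap.mem_eqLocus, LinearMap.sum_apply, Finset.sum_eq_single_of_mem n hn fun m _ hm =>
    hz m n hm x hx, hid n x hx, LinearMap.id_apply]

theorem sum_projection_apply_of_notMem (hz : ∀ m n, m ≠ n → ∀ x ∈ E n, p m x = 0) (G : Finset ℕ)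
    {S : Set ℕ} (hS : ∀ n ∈ S, n ∉ G) {x : M} (hx : x ∈ ⨆ n ∈ S, E n) :
    (∑ n ∈ G, p n) x = 0 := by
  suffices h : (⨆ n ∈ S, E n) ≤ LinearMap.ker (∑ n ∈ G, p n) from h hx
  refine iSup₂_le fun n hn x hx => ?_
  rw [LinearMap.mem_ker, LinearMap.sum_apply]
  exact Finset.sum_eq_zero fun m hm => hz m n (fun h => hS n hn (h ▸ hm)) x hx

theorem sum_projection_mem (hp : ∀ n x, p n x ∈ E n) (G : Finset ℕ) (x : M) :
    (∑ n ∈ G, p n) x ∈ ⨆ n ∈ (G : Set ℕ), E n := by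
  rw [LinearMap.sum_apply]
  exact Submodule.sum_mem _ fun n hn =>
    le_biSup E (Finset.mem_coe.2 hn) (hp n x)

/-- Cutting finitely many summands off a direct sum that is essential in `H` leaves a direct sum
that is essential in the corresponding complement in `H`. -/
theorem EssentialIn.inf_ker_sum_projection (hid : ∀ n, ∀ x ∈ E n, p n x = x)
    (hz : ∀ m n, m ≠ n → ∀ x ∈ E n, p m x = 0) {S S' : Set ℕ} {G : Finset ℕ}
    (hS : S = S' ∪ G) (hd : ∀ n ∈ S', n ∉ G) {H : Submodule A M}
    (hH : EssentialIn (⨆ n ∈ S, E n) H) :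
    EssentialIn (⨆ n ∈ S', E n) (H ⊓ LinearMap.ker (∑ n ∈ G, p n)) := by
  have hle : (⨆ n ∈ S', E n) ≤ H ⊓ LinearMap.ker (∑ n ∈ G, p n) := by
    refine le_inf ((biSup_mono fun n hn => ?_).trans hH.1) fun x hx =>
      sum_projection_apply_of_notMem hz G hd hx
    rw [hS]; exact Or.inl hn
  refine ⟨hle, fun z hzle hza => hH.2 z (hzle.trans inf_le_left) ?_⟩
  have hker : Disjoint (H ⊓ LinearMap.ker (∑ n ∈ G, p n)) (⨆ n ∈ (G : Set ℕ), E n) := by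
    rw [Submodule.disjoint_def]
    intro x hx hxG
    rw [← sum_projection_apply_of_mem hid hz G hxG]
    exact hx.2
  rw [hS, iSup_union]
  exact hza.disjoint_sup_right_of_disjoint_sup_left (hker.mono_left (sup_le hzle hle))

/-- If the sets `B t` are almost disjoint and `⨁ n ∈ B t, E n` is essential in `H t`, then the
images of the `H t` modulo `⨁ n, E n` are independent: any finitely many of the `H t` become
independent after cutting off finitely many summands `E n`. -/
theorem iSupIndep_map_mkQ_of_almostDisjoint (hE : iSupIndep E) (hp : ∀ n x, p n x ∈ E n)
    (hid : ∀ n, ∀ x ∈ E n, p n x = x) (hz : ∀ m n, m ≠ n → ∀ x ∈ E n, p m x = 0)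
    {T : Type*} {B : T → Set ℕ} (hB : ∀ t t', t ≠ t' → (B t ∩ B t').Finite)
    {H : T → Submodule A M} (hH : ∀ t, EssentialIn (⨆ n ∈ B t, E n) (H t)) :
    iSupIndep fun t => (H t).map (⨆ n, E n).mkQ := by
  classical
  rw [iSupIndep_iff_finsetSum_eq_zero_imp_eq_zero]
  intro s v hv hsum
  choose! y hy hyv using hv
  have hyC : ∑ t ∈ s, y t ∈ ⨆ n, E n := by
    have : (⨆ n, E n).mkQ (∑ t ∈ s, y t) = 0 := by
      rw [map_sum, ← hsum]
      exact Finset.sum_congr rfl hyv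
    exact (Submodule.Quotient.mk_eq_zero _).1 this
  obtain ⟨F₀, hF₀⟩ := Submodule.mem_iSup_iff_exists_finset.1 hyC
  -- a finite set outside of which the sets `B t`, for `t ∈ s`, are disjoint
  let F : Finset ℕ := F₀ ∪ s.offDiag.biUnion fun q =>
    if h : q.1 ≠ q.2 then (hB _ _ h).toFinset else ∅
  have hF : ∀ t ∈ s, ∀ t' ∈ s, t ≠ t' → ∀ n, n ∈ B t → n ∈ B t' → n ∈ F := by
    intro t ht t' ht' hne n hn hn'
    refine Finset.mem_union_right _ (Finset.mem_biUnion.2 ⟨(t, t'), ?_, ?_⟩)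
    · simp [ht, ht', hne]
    · simp [hne, hn, hn']
  let G : T → Finset ℕ := fun t => F.filter (· ∈ B t)
  let X : T → Submodule A M := fun t => H t ⊓ LinearMap.ker (∑ n ∈ G t, p n)
  have hX : ∀ t ∈ s, EssentialIn (⨆ n ∈ B t \ F, E n) (X t) := by
    intro t _
    refine (hH t).inf_ker_sum_projection hid hz ?_ ?_
    · ext n
      by_cases hn : n ∈ F <;> simp [G, hn]
    · rintro n hn hnG
      exact hn.2 (Finset.mem_coe.2 (Finset.mem_filter.1 hnG).1)
  have hindep : s.SupIndep fun t => ⨆ n ∈ B t \ F, E n := by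
    intro u hu t ht htu
    refine hE.disjoint_finsetSup_biSup (B := fun t => B t \ F) fun t' ht' => ?_
    rw [Set.disjoint_left]
    intro n hn hn'
    exact hn.2 (hF t ht t' (hu ht') (fun h => htu (h ▸ ht')) n hn.1 hn'.1)
  obtain ⟨hXindep, hXess⟩ := EssentialIn.finsetSup hindep hX
  have hFX : Disjoint (s.sup X) (⨆ n ∈ (F : Set ℕ), E n) := by
    refine hXess.disjoint (hE.disjoint_finsetSup_biSup (B := fun t => B t \ F) fun t _ => ?_).symm
    exact Set.disjoint_sdiff_right
  have hGF : ∀ t x, (∑ n ∈ G t, p n) x ∈ ⨆ n ∈ (F : Set ℕ), E n := fun t x =>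
    SetLike.le_def.1 (biSup_mono fun n hn => (Finset.mem_filter.1 (Finset.mem_coe.1 hn)).1)
      (sum_projection_mem hp (G t) x)
  let y' : T → M := fun t => y t - (∑ n ∈ G t, p n) (y t)
  have hy' : ∀ t ∈ s, y' t ∈ X t := by
    intro t ht
    refine ⟨Submodule.sub_mem _ (hy t ht) ((hH t).1 ?_), ?_⟩
    · exact SetLike.le_def.1
        (biSup_mono fun n hn => (Finset.mem_filter.1 (Finset.mem_coe.1 hn)).2)
        (sum_projection_mem hp (G t) (y t))
    · rw [SetLike.mem_coe, LinearMap.mem_ker, map_sub, sub_eq_zero]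
      exact (sum_projection_apply_of_mem hid hz _ (sum_projection_mem hp _ _)).symm
  have hsum' : ∑ t ∈ s, y' t = 0 := by
    refine Submodule.disjoint_def.1 hFX _ (Submodule.sum_mem _ fun t ht =>
      Finset.le_sup (f := X) ht (hy' t ht)) ?_
    rw [Finset.sum_sub_distrib]
    refine Submodule.sub_mem _ ?_ (Submodule.sum_mem _ fun t _ => hGF t _)
    exact SetLike.le_def.1 (biSup_mono fun n hn => Finset.mem_union_left _ hn) hF₀
  have hzero : ∀ t ∈ s, y' t = 0 := by
    intro t ht
    refine Submodule.disjoint_def.1 (hXindep (Finset.erase_subset t s) ht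
      (Finset.notMem_erase t s)) _ (hy' t ht) ?_
    rw [← Finset.add_sum_erase _ _ ht, add_eq_zero_iff_eq_neg] at hsum'
    rw [hsum']
    exact Submodule.neg_mem _ <| Submodule.sum_mem _ fun i hi =>
      Finset.le_sup (f := X) hi (hy' i (Finset.mem_of_mem_erase hi))
  intro t ht
  rw [← hyv t ht, Submodule.mkQ_apply, Submodule.Quotient.mk_eq_zero, sub_eq_zero.1 (hzero t ht)]
  exact (iSup₂_le fun n _ => le_iSup E n) (hGF t (y t))

end AlmostDisjoint

/-! ### Finitely presented injective modules -/

section FinitePresentation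

variable {A : Type*} [Ring A] {M : Type*} [AddCommGroup M] [Module A M]
  {E : ℕ → Submodule A M} {p : ℕ → M →ₗ[A] M}

theorem Submodule.FG.exists_finset_le_of_le_iSup {N : Submodule A M} (hN : N.FG)
    (h : N ≤ ⨆ n, E n) : ∃ F : Finset ℕ, N ≤ ⨆ n ∈ (F : Set ℕ), E n := by
  obtain ⟨F, hF⟩ := CompleteLattice.IsCompactElement.exists_finset_of_le_iSup _
    ((Submodule.fg_iff_compact N).1 hN) E h
  exact ⟨F, hF⟩

/-- A map from a finitely presented module to `M ⧸ ⨁ n, E n` lifts to `M`: it lifts modulo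
a finite partial sum, which is a direct summand of `M`. -/
theorem exists_lift_mkQ_iSup {P : Type*} [AddCommGroup P] [Module A P]
    [Module.FinitePresentation A P] (hp : ∀ n x, p n x ∈ E n)
    (hid : ∀ n, ∀ x ∈ E n, p n x = x) (hz : ∀ m n, m ≠ n → ∀ x ∈ E n, p m x = 0)
    (θ : P →ₗ[A] M ⧸ ⨆ n, E n) : ∃ ψ : P →ₗ[A] M, (⨆ n, E n).mkQ ∘ₗ ψ = θ := by
  obtain ⟨n, m, f, g, hf, hfg⟩ := Module.FinitePresentation.exists_fin' A P
  obtain ⟨l, hl⟩ := Module.projective_lifting_property (⨆ n, E n).mkQ (θ ∘ₗ f)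
    (Submodule.mkQ_surjective _)
  have hl' : ∀ x, (⨆ n, E n).mkQ (l x) = θ (f x) := fun x => DFunLike.congr_fun hl x
  have hker : (LinearMap.ker f).map l ≤ ⨆ n, E n := by
    rintro _ ⟨x, hx, rfl⟩
    have : (⨆ n, E n).mkQ (l x) = 0 := by rw [hl', LinearMap.mem_ker.1 hx, map_zero]
    simpa using this
  have hfg' : (LinearMap.ker f).FG := by
    rw [LinearMap.exact_iff.1 hfg, LinearMap.range_eq_map]
    exact Module.Finite.fg_top.map g
  obtain ⟨F, hF⟩ := (hfg'.map l).exists_finset_le_of_le_iSup hker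
  have hle : LinearMap.ker f ≤ LinearMap.ker (l - (∑ n ∈ F, p n) ∘ₗ l) := by
    intro x hx
    rw [LinearMap.mem_ker, LinearMap.sub_apply, LinearMap.comp_apply, sub_eq_zero,
      sum_projection_apply_of_mem hid hz F (hF ⟨x, hx, rfl⟩)]
  refine ⟨(LinearMap.ker f).liftQ _ hle ∘ₗ (f.quotKerEquivOfSurjective hf).symm.toLinearMap, ?_⟩
  ext y
  obtain ⟨x, rfl⟩ := hf y
  have hsymm : (f.quotKerEquivOfSurjective hf).symm (f x) = (LinearMap.ker f).mkQ x := by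
    rw [LinearEquiv.symm_apply_eq]; rfl
  have hmem : (∑ n ∈ F, p n) (l x) ∈ ⨆ n, E n :=
    (iSup₂_le fun n _ => le_iSup E n) (sum_projection_mem hp F (l x))
  have hmk : (⨆ n, E n).mkQ ((∑ n ∈ F, p n) (l x)) = 0 :=
    (Submodule.Quotient.mk_eq_zero _).2 hmem
  rw [LinearMap.comp_apply, LinearMap.comp_apply, LinearEquiv.coe_coe, hsymm,
    Submodule.mkQ_apply (LinearMap.ker f), Submodule.liftQ_apply, LinearMap.sub_apply, map_sub,
    LinearMap.comp_apply, hmk, sub_zero, hl']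

/-- The set of codes of the initial segments `(k, t ∩ {0, …, k - 1})` of a set `t` of natural
numbers. For different `t` these infinite sets are almost disjoint, so they form an almost disjoint
family of subsets of `ℕ` indexed by `Set ℕ`. -/
def initialSegments (t : Set ℕ) : Set ℕ :=
  open Classical in
  Set.range fun k : ℕ => Encodable.encode (k, (Finset.range k).filter (· ∈ t))

theorem initialSegments_infinite (t : Set ℕ) : (initialSegments t).Infinite := by
  refine Set.infinite_range_of_injective fun k k' h => ?_
  exact congrArg Prod.fst (Encodable.encode_injective h)

theorem initialSegments_inter_finite {t t' : Set ℕ} (h : t ≠ t') :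
    (initialSegments t ∩ initialSegments t').Finite := by
  classical
  obtain ⟨m, hm⟩ : ∃ m, ¬ (m ∈ t ↔ m ∈ t') := by
    by_contra! hc
    exact h (Set.ext hc)
  refine ((Finset.range (m + 1)).image fun k : ℕ =>
    Encodable.encode (k, (Finset.range k).filter (· ∈ t))).finite_toSet.subset ?_
  rintro _ ⟨⟨k, rfl⟩, k', hk'⟩
  have h' := Encodable.encode_injective hk'
  rw [Prod.mk.injEq] at h'
  obtain ⟨rfl, h2⟩ := h'
  rw [Finset.coe_image]
  refine ⟨k', ?_, by dsimp only⟩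
  rw [Finset.mem_coe, Finset.mem_range]
  by_contra! hlt
  refine hm ?_
  have := Finset.ext_iff.1 h2 m
  simp only [Finset.mem_filter, Finset.mem_range] at this
  tauto

/-- A finitely presented injective module with injective quotients has no infinite independent
sequence `N` of nonzero submodules. One may replace `N n` by an essential extension `E n` that is
a direct summand. For every set `S` of subsets of `ℕ` there is an endomorphism `ψ` which, modulo
`⨁ n, E n`, is the identity on the hull `H t` of `⨁ n ∈ initialSegments t, E n` for `t ∈ S` and
zero on `H t` for `t ∉ S`. As `H t` is finitely generated, the set of those `n` for which `ψ` acts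
on `E n` as the identity, up to the other summands, almost contains `initialSegments t` if `t ∈ S`
and is almost disjoint from it otherwise. So this subset of `ℕ` determines `S`, against Cantor's
theorem. -/
theorem exists_eq_bot_of_iSupIndep [Module.FinitePresentation A M] (hM : Module.Baer A M)
    (hq : ∀ L : Submodule A M, Module.Baer A (M ⧸ L)) {N : ℕ → Submodule A M}
    (hN : iSupIndep N) : ∃ n, N n = ⊥ := by
  by_contra! hne
  choose E r hNE hrE hr using fun n => exists_essentialIn_retraction hM hq (N n)
  have hE : iSupIndep E := iSupIndep_iff_supIndep.2 fun s =>
    (EssentialIn.finsetSup (hN.supIndep' s) fun n _ => hNE n).1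
  have hEne : ∀ n, E n ≠ ⊥ := fun n h => hne n (le_bot_iff.1 (h ▸ (hNE n).1))
  have hproj : ∀ n, ∃ p : M →ₗ[A] M, (∀ x, p x ∈ E n) ∧ (∀ x ∈ E n, p x = x) ∧
      ∀ m ≠ n, ∀ x ∈ E m, p x = 0 := by
    intro n
    obtain ⟨q, hq1, hq2⟩ := hM.exists_extend_of_disjoint (hE n) (E n).subtype
    refine ⟨r n ∘ₗ q, fun x => hrE n _, fun x hx => ?_, fun m hm x hx => ?_⟩
    · rw [LinearMap.comp_apply, hq1 ⟨x, hx⟩]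
      exact hr n x hx
    · rw [LinearMap.comp_apply, hq2 x (Submodule.mem_iSup_of_mem m
        (Submodule.mem_iSup_of_mem hm hx)), map_zero]
  choose p hp hid hz' using hproj
  have hz : ∀ m n, m ≠ n → ∀ x ∈ E n, p m x = 0 := fun m n h => hz' m n h.symm
  choose H ρ hH hρH hρ using fun t : Set ℕ =>
    exists_essentialIn_retraction hM hq (⨆ n ∈ initialSegments t, E n)
  have hHfg : ∀ t, (H t).FG := by
    intro t
    have : H t = Submodule.map (ρ t) ⊤ := by
      refine le_antisymm (fun x hx => ⟨x, trivial, hρ t x hx⟩) ?_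
      rintro _ ⟨x, -, rfl⟩
      exact hρH t x
    rw [this]
    exact Module.Finite.fg_top.map _
  have hEH : ∀ t, ∀ n ∈ initialSegments t, E n ≤ H t := fun t n hn =>
    (le_biSup E hn).trans (hH t).1
  have hindep := iSupIndep_map_mkQ_of_almostDisjoint hE hp hid hz
    (fun t t' => initialSegments_inter_finite) hH
  have hψ : ∀ S : Set (Set ℕ), ∃ ψ : M →ₗ[A] M,
      (∀ t ∈ S, ∀ x ∈ H t, ψ x - x ∈ ⨆ n, E n) ∧ ∀ t ∉ S, ∀ x ∈ H t, ψ x ∈ ⨆ n, E n := by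
    intro S
    obtain ⟨φ, hφ1, hφ2⟩ := (hq (⨆ n, E n)).exists_extend_of_disjoint
      (hindep.disjoint_biSup_biSup (disjoint_compl_right (a := S))) (Submodule.subtype _)
    obtain ⟨ψ, hψ⟩ := exists_lift_mkQ_iSup hp hid hz (φ ∘ₗ (⨆ n, E n).mkQ)
    have hψ' : ∀ x, (⨆ n, E n).mkQ (ψ x) = φ ((⨆ n, E n).mkQ x) := DFunLike.congr_fun hψ
    refine ⟨ψ, fun t ht x hx => ?_, fun t ht x hx => ?_⟩
    · have h1 := hφ1 ⟨(⨆ n, E n).mkQ x, le_biSup (fun t => (H t).map (⨆ n, E n).mkQ) ht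
        ⟨x, hx, rfl⟩⟩
      have h2 : (⨆ n, E n).mkQ (ψ x - x) = 0 := by
        rw [map_sub, hψ', h1, Submodule.subtype_apply, sub_self]
      simpa only [Submodule.mkQ_apply, Submodule.Quotient.mk_eq_zero] using h2
    · have h1 := hφ2 ((⨆ n, E n).mkQ x) (le_biSup (fun t => (H t).map (⨆ n, E n).mkQ)
        (show t ∈ Sᶜ from ht) ⟨x, hx, rfl⟩)
      have h2 : (⨆ n, E n).mkQ (ψ x) = 0 := by rw [hψ', h1]
      simpa only [Submodule.mkQ_apply, Submodule.Quotient.mk_eq_zero] using h2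
  choose ψ hψ1 hψ0 using hψ
  have hzero : ∀ F : Finset ℕ, ∀ n ∉ F, ∀ x ∈ ⨆ m ∈ (F : Set ℕ), E m, p n x = 0 := by
    intro F n hn x hx
    have := sum_projection_apply_of_notMem hz {n} (S := F) (by
      rintro m hm hmn
      rw [Finset.mem_singleton] at hmn
      exact hn (hmn ▸ hm)) hx
    simpa using this
  let D : Set (Set ℕ) → Set ℕ := fun S => {n | ∀ x ∈ E n, p n (ψ S x) = x}
  have hD1 : ∀ S, ∀ t ∈ S, (initialSegments t \ D S).Finite := by
    intro S t ht
    obtain ⟨F, hF⟩ := ((hHfg t).map (ψ S - LinearMap.id)).exists_finset_le_of_le_iSup (E := E) (by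
      rintro _ ⟨x, hx, rfl⟩
      exact hψ1 S t ht x hx)
    refine F.finite_toSet.subset fun n hn => ?_
    by_contra hnF
    refine hn.2 fun x hx => ?_
    have := hzero F n hnF _ (hF ⟨x, hEH t n hn.1 hx, rfl⟩)
    rwa [LinearMap.sub_apply, map_sub, LinearMap.id_apply, hid n x hx, sub_eq_zero] at this
  have hD0 : ∀ S, ∀ t ∉ S, (initialSegments t ∩ D S).Finite := by
    intro S t ht
    obtain ⟨F, hF⟩ := ((hHfg t).map (ψ S)).exists_finset_le_of_le_iSup (E := E) (by
      rintro _ ⟨x, hx, rfl⟩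
      exact hψ0 S t ht x hx)
    refine F.finite_toSet.subset fun n hn => ?_
    by_contra hnF
    refine hEne n ((Submodule.eq_bot_iff _).2 fun x hx => ?_)
    rw [← hn.2 x hx]
    exact hzero F n hnF _ (hF ⟨x, hEH t n hn.1 hx, rfl⟩)
  have hle : ∀ S S', D S = D S' → S ⊆ S' := by
    intro S S' h t ht
    by_contra ht'
    have h1 := hD1 S t ht
    rw [h] at h1
    exact initialSegments_infinite t (Set.sdiff_union_inter (initialSegments t) (D S') ▸
      h1.union (hD0 S' t ht'))
  exact Function.cantor_injective D fun S S' h => (hle S S' h).antisymm (hle S' S h.symm)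

end FinitePresentation

/-! ### Submodules of free modules over a hereditary ring -/

section Hereditary

variable {A : Type*} [Ring A]

theorem IsHereditaryModule.projective_of_injective {M M' : Type*} [AddCommGroup M] [Module A M]
    [AddCommGroup M'] [Module A M'] (h : IsHereditaryModule A M') (j : M →ₗ[A] M')
    (hj : Function.Injective j) : Module.Projective A M :=
  have := h (LinearMap.range j)
  Module.Projective.of_equiv (LinearEquiv.ofInjective j hj).symm

theorem IsHereditaryModule.of_injective {M M' : Type*} [AddCommGroup M] [Module A M]
    [AddCommGroup M'] [Module A M'] (h : IsHereditaryModule A M') (j : M →ₗ[A] M')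
    (hj : Function.Injective j) : IsHereditaryModule A M := fun N =>
  h.projective_of_injective (j ∘ₗ N.subtype) (hj.comp N.injective_subtype)

theorem IsHereditaryModule.of_ker {M M' : Type*} [AddCommGroup M] [Module A M]
    [AddCommGroup M'] [Module A M'] (f : M →ₗ[A] M')
    (hker : IsHereditaryModule A (LinearMap.ker f)) (h : IsHereditaryModule A M') :
    IsHereditaryModule A M := by
  intro N
  let g := f ∘ₗ N.subtype
  have h1 : Module.Projective A (LinearMap.range g) := h _
  have h2 : Module.Projective A (LinearMap.ker g) := by
    refine hker.projective_of_injective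
      ((N.subtype ∘ₗ (LinearMap.ker g).subtype).codRestrict _ fun x => x.2) fun x y hxy => ?_
    exact Subtype.ext (Subtype.ext (congrArg (LinearMap.ker f).subtype hxy :))
  obtain ⟨s, hs⟩ := LinearMap.exists_rightInverse_of_surjective g.rangeRestrict g.range_rangeRestrict
  have hs' : ∀ y, g (s y) = y := fun y => congrArg Subtype.val (DFunLike.congr_fun hs y)
  have hmem : ∀ x, (LinearMap.id - s ∘ₗ g.rangeRestrict : N →ₗ[A] N) x ∈ LinearMap.ker g := by
    intro x
    refine (map_sub g x (s (g.rangeRestrict x))).trans ?_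
    rw [hs', sub_eq_zero]
    rfl
  refine Module.Projective.of_split (M := LinearMap.ker g × LinearMap.range g)
    (LinearMap.prod (LinearMap.codRestrict (LinearMap.ker g) _ hmem) g.rangeRestrict)
    (LinearMap.coprod (LinearMap.ker g).subtype s) ?_
  ext x
  simp

theorem IsHereditaryModule.pi_fin (h : IsHereditaryModule A A) (n : ℕ) :
    IsHereditaryModule A (Fin n → A) := by
  induction n with
  | zero => exact h.of_injective 0 (Function.injective_of_subsingleton _)
  | succ n ih =>
    refine IsHereditaryModule.of_ker (LinearMap.proj 0) (ih.of_injective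
      (LinearMap.funLeft A A Fin.succ ∘ₗ Submodule.subtype _) fun x y hxy => ?_) h
    refine Subtype.ext (funext fun i => ?_)
    induction i using Fin.cases with
    | zero => exact (LinearMap.mem_ker.1 x.2).trans (LinearMap.mem_ker.1 y.2).symm
    | succ i => exact congrFun hxy i

end Hereditary

/-! ### Independent sequences in modules that are not noetherian -/

section Noetherian

variable {A : Type*} [Ring A] {M : Type*} [AddCommGroup M] [Module A M]

theorem iSupIndep_of_monotone_of_disjoint {W N : ℕ → Submodule A M} (hW : Monotone W)
    (hle : ∀ n, N n ≤ W (n + 1)) (hd : ∀ n, Disjoint (N n) (W n)) : iSupIndep N := by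
  have hsup : ∀ k, (Finset.range k).sup N ≤ W k := fun k => Finset.sup_le fun i hi =>
    (hle i).trans (hW (Finset.mem_range.1 hi))
  have h : ∀ k, (Finset.range k).SupIndep N := by
    intro k
    induction k with
    | zero => exact Finset.supIndep_empty _
    | succ k ih =>
      rw [Finset.range_add_one]
      exact ih.insert ((hd k).mono_right (hsup k))
  refine iSupIndep_iff_supIndep.2 fun s => (h (s.sup id + 1)).subset fun i hi => ?_
  exact Finset.mem_range.2 (Nat.lt_succ_of_le (Finset.le_sup (f := id) hi))

/-- A projective module `P` that is not finitely generated, presented as a direct summand of a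
free module, is filtered by the submodules of elements with support in a finite set `G`. Any such
submodule `W` is followed by a larger one containing a nonzero submodule `C` disjoint from `W`:
some coordinate outside `G` does not vanish identically, and its image, being an ideal, is
projective. -/
theorem exists_iSupIndep_of_projective_of_not_fg (hA : IsHereditaryModule A A) {P : Type*}
    [AddCommGroup P] [Module A P] [Module.Projective A P] (hP : ¬ Module.Finite A P)
    {K : Submodule A P} (hK : K.FG) :
    ∃ W C : ℕ → Submodule A P, Monotone W ∧ K ≤ W 0 ∧ (∀ n, C n ≠ ⊥) ∧
      (∀ n, C n ≤ W (n + 1)) ∧ ∀ n, Disjoint (C n) (W n) := by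
  classical
  obtain ⟨s, hs⟩ := Module.projective_def.1 (inferInstance : Module.Projective A P)
  let W : Finset P → Submodule A P := fun G => (Finsupp.supported A A (G : Set P)).comap s
  have hWmono : Monotone W := fun G G' h => Submodule.comap_mono (Finsupp.supported_mono h)
  have hmem : ∀ x, x ∈ W (s x).support := fun x => (Finsupp.mem_supported A _).2 subset_rfl
  have hWtop : ∀ G, W G ≠ ⊤ := by
    intro G hG
    refine hP ⟨G, eq_top_iff.2 fun x _ => ?_⟩
    have hx : x ∈ W G := hG ▸ Submodule.mem_top
    rw [← hs x]
    refine Submodule.sum_mem _ fun y hy => Submodule.smul_mem _ _ (Submodule.subset_span ?_)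
    exact (Finsupp.mem_supported A _).1 hx hy
  have hstep : ∀ G, ∃ G' : Finset P, G ⊆ G' ∧ ∃ C : Submodule A P, C ≠ ⊥ ∧ C ≤ W G' ∧
      Disjoint C (W G) := by
    intro G
    obtain ⟨x, hx⟩ : ∃ x, x ∉ W G := by
      by_contra! h
      exact hWtop G (eq_top_iff.2 fun x _ => h x)
    obtain ⟨j, hj, hjG⟩ := Set.not_subset.1 (fun h => hx ((Finsupp.mem_supported A _).2 h))
    let G' := G ∪ (s x).support
    let τ : W G' →ₗ[A] A := Finsupp.lapply j ∘ₗ s ∘ₗ (W G').subtype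
    have := hA (LinearMap.range τ)
    obtain ⟨k, hk⟩ := LinearMap.exists_rightInverse_of_surjective τ.rangeRestrict
      τ.range_rangeRestrict
    have hk' : ∀ y, τ (k y) = y := fun y => congrArg Subtype.val (DFunLike.congr_fun hk y)
    refine ⟨G', Finset.subset_union_left, LinearMap.range ((W G').subtype ∘ₗ k), ?_, ?_, ?_⟩
    · intro hbot
      let x' : W G' := ⟨x, hWmono Finset.subset_union_right (hmem x)⟩
      have h1 : k (τ.rangeRestrict x') = 0 := by
        have : ((k (τ.rangeRestrict x') : W G') : P) ∈ (⊥ : Submodule A P) :=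
          hbot ▸ ⟨_, rfl⟩
        exact Subtype.ext ((Submodule.mem_bot A).1 this)
      have h2 := hk' (τ.rangeRestrict x')
      rw [h1, map_zero] at h2
      exact Finsupp.mem_support_iff.1 (Finset.mem_coe.1 hj) h2.symm
    · rintro _ ⟨y, rfl⟩
      exact (k y).2
    · rw [Submodule.disjoint_def]
      rintro _ ⟨y, rfl⟩ hy
      have h1 : τ (k y) = 0 := by
        by_contra h
        exact hjG ((Finsupp.mem_supported A _).1 hy (Finset.mem_coe.2 (Finsupp.mem_support_iff.2 h)))
      rw [hk'] at h1
      rw [Subtype.ext (a1 := y) (a2 := 0) h1, map_zero]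
  choose next hnext C hC hCle hCd using hstep
  obtain ⟨T, rfl⟩ := hK
  let G₀ : Finset P := T.biUnion fun x => (s x).support
  let G : ℕ → Finset P := fun n => next^[n] G₀
  have hG : ∀ n, G (n + 1) = next (G n) := fun n => Function.iterate_succ_apply' next n G₀
  refine ⟨fun n => W (G n), fun n => C (G n), ?_, ?_, fun n => hC _, fun n => ?_, fun n => hCd _⟩
  · exact monotone_nat_of_le_succ fun n => hWmono (hG n ▸ hnext (G n))
  · refine Submodule.span_le.2 fun x hx => ?_
    exact hWmono (Finset.subset_biUnion_of_mem (fun x => (s x).support) (Finset.mem_coe.1 hx))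
      (hmem x)
  · change C (G n) ≤ W (G (n + 1))
    rw [hG]
    exact hCle _

/-- The preimage in a free module of a submodule that is not finitely generated is projective and
not finitely generated. The summands of it that miss the finitely many relations survive in `M`. -/
theorem isNoetherian_of_forall_iSupIndep [Module.FinitePresentation A M]
    (hA : IsHereditaryModule A A)
    (h : ∀ N : ℕ → Submodule A M, iSupIndep N → ∃ n, N n = ⊥) : IsNoetherian A M := by
  obtain ⟨n, m, f, g, hf, hfg⟩ := Module.FinitePresentation.exists_fin' A M
  have hker : (LinearMap.ker f).FG := by
    rw [LinearMap.exact_iff.1 hfg, LinearMap.range_eq_map]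
    exact Module.Finite.fg_top.map g
  refine ⟨fun L => ?_⟩
  by_contra hL
  let P := L.comap f
  have hmap : P.map f = L := Submodule.map_comap_eq_of_surjective hf L
  have hPfg : ¬ Module.Finite A P := fun hfin =>
    hL (hmap ▸ (Module.Finite.iff_fg.1 hfin).map f)
  have : Module.Projective A P := hA.pi_fin n P
  have hKP : LinearMap.ker f ≤ P := LinearMap.ker_le_comap f
  have hK : ((LinearMap.ker f).comap P.subtype).FG := by
    refine Submodule.fg_of_fg_map_injective P.subtype P.injective_subtype ?_
    rwa [Submodule.map_comap_eq, Submodule.range_subtype, inf_eq_right.2 hKP]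
  obtain ⟨W, C, hW, hKW, hC, hCW, hd⟩ := exists_iSupIndep_of_projective_of_not_fg hA hPfg hK
  let q : P →ₗ[A] M := f ∘ₗ P.subtype
  have hq : ∀ x y, q x = q y → x - y ∈ W 0 := by
    intro x y hxy
    refine hKW ?_
    rw [Submodule.mem_comap, LinearMap.mem_ker]
    change q (x - y) = 0
    rw [map_sub, hxy, sub_self]
  have hindep : iSupIndep fun k => (C k).map q := by
    refine iSupIndep_of_monotone_of_disjoint (W := fun k => (W k).map q)
      (fun k k' hk => Submodule.map_mono (hW hk)) (fun k => Submodule.map_mono (hCW k)) fun k => ?_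
    rw [Submodule.disjoint_def]
    rintro _ ⟨x, hx, rfl⟩ ⟨y, hy, hxy⟩
    have hxW : x ∈ W k := by
      have := (W k).add_mem (hW (Nat.zero_le k) (hq x y hxy.symm)) hy
      rwa [sub_add_cancel] at this
    rw [Submodule.disjoint_def.1 (hd k) x hx hxW, map_zero]
  obtain ⟨k, hk⟩ := h _ hindep
  refine hC k ((Submodule.eq_bot_iff _).2 fun x hx => ?_)
  have h0 : q x = q 0 := by
    have : q x ∈ (C k).map q := ⟨x, hx, rfl⟩
    rwa [hk, Submodule.mem_bot, ← map_zero q] at this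
  have := hW (Nat.zero_le k) (hq x 0 h0)
  rw [sub_zero] at this
  exact Submodule.disjoint_def.1 (hd k) x hx this

end Noetherian

/-! ### Noetherian modules have finite Goldie dimension -/

section Goldie

/-- In a modular lattice with ascending chain condition every nonzero `a` lies above a uniform `w`:
choose `y` maximal among the elements disjoint from some nonzero `w ≤ a`. If `w` had nonzero
disjoint `x` and `z` below it, then `y ⊔ x` would be larger and disjoint from `z`. -/
theorem exists_uniform_le {α : Type*} [Lattice α] [OrderBot α] [IsModularLattice α]
    [WellFoundedGT α] {a : α} (ha : a ≠ ⊥) :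
    ∃ w ≤ a, w ≠ ⊥ ∧ ∀ x ≤ w, ∀ y ≤ w, Disjoint x y → x = ⊥ ∨ y = ⊥ := by
  obtain ⟨y, ⟨w, hwa, hw, hyw⟩, hmax⟩ := WellFounded.has_min (wellFounded_gt (α := α))
    {y | ∃ w ≤ a, w ≠ ⊥ ∧ Disjoint y w} ⟨⊥, a, le_rfl, ha, disjoint_bot_left⟩
  refine ⟨w, hwa, hw, fun x hx z hz hxz => ?_⟩
  by_contra! hne
  refine hmax (y ⊔ x) ⟨z, hz.trans hwa, hne.2, ?_⟩ ?_
  · exact hxz.disjoint_sup_left_of_disjoint_sup_right (hyw.mono_right (sup_le hx hz))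
  · refine lt_of_le_of_ne le_sup_left fun h => hne.1 ?_
    exact disjoint_self.1 ((hyw.mono_right hx).mono_left (h ▸ le_sup_right))

/-- Exchange: a uniform `w` disjoint from `v` can replace one of the members of a family that is
independent over `v`. -/
theorem exists_erase_disjoint_sup_uniform {α : Type*} [Lattice α] [OrderBot α]
    [IsModularLattice α] [DecidableEq α] {s : Finset α} (hs : s.Nonempty) (hind : s.SupIndep id)
    {v w : α} (hv : Disjoint v (s.sup id)) (hvw : Disjoint v w)
    (hw : ∀ x ≤ w, ∀ y ≤ w, Disjoint x y → x = ⊥ ∨ y = ⊥) :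
    ∃ j ∈ s, Disjoint (v ⊔ w) ((s.erase j).sup id) := by
  have hkey : ∃ j ∈ s, Disjoint w (v ⊔ (s.erase j).sup id) := by
    by_contra! hall
    -- a minimal `t ⊆ s` such that `w` meets `v ⊔ t.sup id`
    obtain ⟨j₀, hj₀⟩ := hs
    obtain ⟨t, ⟨hts, htw⟩, hmin⟩ := WellFounded.has_min (wellFounded_lt (α := Finset α))
      {t | t ⊆ s ∧ ¬ Disjoint w (v ⊔ t.sup id)}
      ⟨s.erase j₀, Finset.erase_subset _ _, hall j₀ hj₀⟩
    obtain ⟨j, hj⟩ : t.Nonempty := by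
      rw [Finset.nonempty_iff_ne_empty]
      rintro rfl
      exact htw (by simpa using hvw.symm)
    have hdis : Disjoint w (v ⊔ (t.erase j).sup id) := by
      by_contra h
      exact hmin _ ⟨(Finset.erase_subset _ _).trans hts, h⟩ (Finset.erase_ssubset hj)
    have hinf : (v ⊔ t.sup id) ⊓ (v ⊔ (s.erase j).sup id) ≤ v ⊔ (t.erase j).sup id := by
      have hd : Disjoint j (v ⊔ (s.erase j).sup id) := by
        have h1 : Disjoint j ((s.erase j).sup id) :=
          hind (Finset.erase_subset j s) (hts hj) (Finset.notMem_erase j s)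
        rw [sup_comm]
        refine h1.disjoint_sup_right_of_disjoint_sup_left ?_
        have : j ⊔ (s.erase j).sup id = s.sup id := by
          conv_rhs => rw [← Finset.insert_erase (hts hj), Finset.sup_insert, id]
        rw [this]
        exact hv.symm
      have hle : v ⊔ (t.erase j).sup id ≤ v ⊔ (s.erase j).sup id :=
        sup_le_sup_left (Finset.sup_mono (Finset.erase_subset_erase j hts)) v
      have heq : v ⊔ t.sup id = v ⊔ (t.erase j).sup id ⊔ j := by
        conv_lhs => rw [← Finset.insert_erase hj, Finset.sup_insert, id, sup_comm j, ← sup_assoc]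
      rw [heq, sup_inf_assoc_of_le j hle, hd.eq_bot, sup_bot_eq]
    have hdis' : Disjoint (w ⊓ (v ⊔ t.sup id)) (w ⊓ (v ⊔ (s.erase j).sup id)) := by
      rw [disjoint_iff_inf_le]
      refine le_trans (le_inf (inf_le_left.trans inf_le_left) ?_) hdis.le_bot
      exact le_trans (inf_le_inf inf_le_right inf_le_right) hinf
    rcases hw _ inf_le_left _ inf_le_left hdis' with h | h
    · exact htw (disjoint_iff.2 h)
    · exact hall j (hts hj) (disjoint_iff.2 h)
  obtain ⟨j, hj, hd⟩ := hkey
  refine ⟨j, hj, ?_⟩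
  rw [sup_comm v w]
  have hvj := hv.mono_right (Finset.sup_mono (f := id) (Finset.erase_subset j s))
  exact hvj.disjoint_sup_left_of_disjoint_sup_right hd

/-- In a modular lattice with ascending chain condition the independent families of nonzero
elements are bounded in size: otherwise there is a maximal `v` over which such families are
unbounded, and adjoining to `v` a uniform element disjoint from it costs each family one member. -/
theorem exists_card_le_of_supIndep {α : Type*} [Lattice α] [OrderBot α] [IsModularLattice α]
    [WellFoundedGT α] :
    ∃ n : ℕ, ∀ s : Finset α, s.SupIndep id → ⊥ ∉ s → s.card ≤ n := by
  classical
  by_contra! hunb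
  obtain ⟨v, hv, hmax⟩ := WellFounded.has_min (wellFounded_gt (α := α))
    {v | ∀ n : ℕ, ∃ s : Finset α, s.SupIndep id ∧ ⊥ ∉ s ∧ n < s.card ∧ Disjoint v (s.sup id)}
    ⟨⊥, fun n => (hunb n).imp fun s hs => ⟨hs.1, hs.2.1, hs.2.2, disjoint_bot_left⟩⟩
  obtain ⟨s₀, -, hs₀, hcard, hvs₀⟩ := hv 0
  obtain ⟨a, ha⟩ := Finset.card_pos.1 hcard
  obtain ⟨w, hwa, hw, huni⟩ := exists_uniform_le (ne_of_mem_of_not_mem ha hs₀)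
  have hvw : Disjoint v w := hvs₀.mono_right (hwa.trans (Finset.le_sup (f := id) ha))
  refine hmax (v ⊔ w) (fun n => ?_) (lt_of_le_of_ne le_sup_left fun h => hw ?_)
  · obtain ⟨s, hind, hbot, hn, hvs⟩ := hv (n + 1)
    obtain ⟨j, hj, hd⟩ := exists_erase_disjoint_sup_uniform
      (Finset.card_pos.1 ((Nat.zero_le _).trans_lt hn)) hind hvs hvw huni
    refine ⟨s.erase j, hind.subset (Finset.erase_subset _ _),
      fun h => hbot (Finset.mem_of_mem_erase h), ?_, hd⟩
    rw [Finset.card_erase_of_mem hj]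
    omega
  · exact disjoint_self.1 (hvw.mono_left (h ▸ le_sup_right))

theorem goldieDim_lt_aleph0_of_isNoetherian (A : Type*) [Ring A] (M : Type*) [AddCommGroup M]
    [Module A M] [IsNoetherian A M] : goldieDim A M < Cardinal.aleph0 := by
  classical
  obtain ⟨n, hn⟩ := exists_card_le_of_supIndep (α := Submodule A M)
  refine (csSup_le' ?_).trans_lt (Cardinal.natCast_lt_aleph0 (n := n))
  rintro c ⟨ι, N, hN, hind, rfl⟩
  by_contra! hlt
  replace hlt := Order.succ_le_of_lt hlt
  rw [Cardinal.succ_natCast] at hlt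
  obtain ⟨e⟩ : Nonempty (Fin (n + 1) ↪ ι) := by
    rw [← Cardinal.lift_mk_le']
    simpa using hlt
  have hinj : Function.Injective (N ∘ e) := (hind.injective hN).comp e.injective
  have hcard := hn (Finset.univ.image (N ∘ e)) (((hind.comp e.injective).supIndep'
    Finset.univ).image (f := id)) (by simp [hN])
  rw [Finset.card_image_of_injective _ hinj, Finset.card_univ, Fintype.card_fin] at hcard
  omega

end Goldie

/-! ### The theorem -/

theorem corollary3p5 (R : Type u) [Ring R] (hR : IsRightHereditary R)
    (E : Type (max u v)) [AddCommGroup E] [Module Rᵐᵒᵖ E]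
    (hfp : Module.FinitePresentation Rᵐᵒᵖ E) (hinj : Module.Injective Rᵐᵒᵖ E)
    (L : Submodule Rᵐᵒᵖ E) :
    goldieDim Rᵐᵒᵖ (E ⧸ L) < Cardinal.aleph0 := by
  have hA : IsHereditaryModule Rᵐᵒᵖ Rᵐᵒᵖ := IsHereditaryModule.of_injective hR
    { toFun := MulOpposite.unop, map_add' := fun _ _ => rfl, map_smul' := fun _ _ => rfl }
    MulOpposite.unop_injective
  have hE : Module.Baer Rᵐᵒᵖ E := Module.Baer.of_injective hinj
  have : IsNoetherian Rᵐᵒᵖ E := isNoetherian_of_forall_iSupIndep hA fun N hN =>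
    exists_eq_bot_of_iSupIndep hE (hE.quotient hA) hN
  exact goldieDim_lt_aleph0_of_isNoetherian _ _
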